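/- Let $n \ge 0$ and $R_n = \mathbb{Q}[x_1,\dots,x_n]$. A polynomial $f \in R_n$ is quasisymmetric if for all $k \ge 0$, all positive integers $a_1,\dots,a_k$ and all indices $1 \le i_1 < \cdots < i_k \le n$ and $1 \le j_1 < \cdots < j_k \le n$, the coefficients of $x_{i_1}^{a_1}\cdots x_{i_k}^{a_k}$ and $x_{j_1}^{a_1}\cdots x_{j_k}^{a_k}$ in $f$ are equal. Let $\langle \mathrm{QSym}_n^+\rangle \subseteq R_n$ be the ideal generated by the quasisymmetric polynomials with zero constant term. A noncrossing partition $\lambda$ of size $n$ is a set of arcs $(i,j)$, $1 \le i < j \le n$, such that no two distinct arcs $(i,k),(j,l)\in\lambda$ satisfy $i \le j < k \le l$; it is also regarded as an undirected graph on $\{1,\dots,n\}$. Its permutation $Q_\lambda \in S_n$ is defined by $Q_\lambda(j) = i$ if $(i,j) \in \lambda$ for some (necessarily unique) $i$, and otherwise $Q_\lambda(j)$ is the largest element of the connected component of $j$ in $\lambda$. Let $\mathrm{QSV}_n = \{Q_\lambda\} \subseteq S_n$, where $\lambda$ runs over all noncrossing partitions of size $n$; identify $\sigma \in S_n$ with the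 point $(\sigma(1),\dots,\sigma(n)) \in \mathbb{Q}^n$, and let $\mathbf{I}(\mathrm{QSV}_n) \subseteq R_n$ be the ideal of all polynomials that vanish at every point of $\mathrm{QSV}_n$. Then $$R_n/\langle \mathrm{QSym}_n^+\rangle \;\cong\; R_n/\mathbf{I}(\mathrm{QSV}_n)$$ as $\mathbb{Q}$-vector spaces, and both quotients have dimension over $\mathbb{Q}$ equal to the Catalan number $C_n = \frac{1}{n+1}\binom{2n}{n}$. -/

import Mathlib

namespace QuasisymmetricVariety

/-- A noncrossing partition of size `n`: a set of arcs `(i, j)` with `i < j` on the vertices of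
`Fin n` (vertex `i : Fin n` stands for the integer `i + 1`), such that no two distinct arcs
`(i, k)`, `(j, l)` satisfy `i ≤ j < k ≤ l` (no intersections, no common left endpoint and no
common right endpoint). -/
structure NCP (n : ℕ) where
  arcs : Finset (Fin n × Fin n)
  lt_of_mem : ∀ {i j : Fin n}, (i, j) ∈ arcs → i < j
  noncrossing : ∀ {i j k l : Fin n}, (i, k) ∈ arcs → (j, l) ∈ arcs → (i, k) ≠ (j, l) →
    ¬ (i ≤ j ∧ j < k ∧ k ≤ l)

namespace NCP

variable {n : ℕ} (lam : NCP n)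

/-- The noncrossing partition considered as an undirected graph. -/
def graph : SimpleGraph (Fin n) := SimpleGraph.fromRel fun i j => (i, j) ∈ lam.arcs

open Classical in
/-- The connected component of `j`, as a finite set. -/
noncomputable def component (j : Fin n) : Finset (Fin n) :=
  Finset.univ.filter fun k => lam.graph.Reachable j k

theorem self_mem_component (j : Fin n) : j ∈ lam.component j := by
  simp [component]

open Classical in
/-- `j` is sent to its leftward neighbour if `j` is a right endpoint, and to the largest element
of its connected component otherwise. -/
noncomputable def qFun (j : Fin n) : Fin n :=
  if h : ∃ i, (i, j) ∈ lam.arcs then h.choose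
  else (lam.component j).max' ⟨j, lam.self_mem_component j⟩

variable {lam}

theorem left_unique {i i' j : Fin n} (h : (i, j) ∈ lam.arcs) (h' : (i', j) ∈ lam.arcs) :
    i = i' := by
  by_contra hne
  rcases lt_or_gt_of_ne hne with hl | hl
  · exact lam.noncrossing h h' (by simp [hne]) ⟨hl.le, lam.lt_of_mem h', le_rfl⟩
  · exact lam.noncrossing h' h (by simp [Ne.symm hne]) ⟨hl.le, lam.lt_of_mem h, le_rfl⟩

theorem right_unique {i j j' : Fin n} (h : (i, j) ∈ lam.arcs) (h' : (i, j') ∈ lam.arcs) :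
    j = j' := by
  by_contra hne
  rcases lt_or_gt_of_ne hne with hl | hl
  · exact lam.noncrossing h h' (by simp [hne]) ⟨le_rfl, lam.lt_of_mem h, hl.le⟩
  · exact lam.noncrossing h' h (by simp [Ne.symm hne]) ⟨le_rfl, lam.lt_of_mem h', hl.le⟩

theorem qFun_of_mem {i j : Fin n} (h : (i, j) ∈ lam.arcs) : lam.qFun j = i := by
  have hex : ∃ i, (i, j) ∈ lam.arcs := ⟨i, h⟩
  rw [qFun, dif_pos hex]
  exact left_unique hex.choose_spec h

theorem qFun_of_not {j : Fin n} (h : ¬ ∃ i, (i, j) ∈ lam.arcs) :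
    lam.qFun j = (lam.component j).max' ⟨j, lam.self_mem_component j⟩ := by
  rw [qFun, dif_neg h]

theorem adj_of_mem {i j : Fin n} (h : (i, j) ∈ lam.arcs) : lam.graph.Adj i j := by
  rw [graph, SimpleGraph.fromRel_adj]
  exact ⟨(lam.lt_of_mem h).ne, Or.inl h⟩

theorem chain_of_reachable {x y : Fin n} (h : lam.graph.Reachable x y) :
    Relation.ReflTransGen (fun i j => (i, j) ∈ lam.arcs) x y ∨
      Relation.ReflTransGen (fun i j => (i, j) ∈ lam.arcs) y x := by
  rw [SimpleGraph.reachable_iff_reflTransGen] at h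
  induction h with
  | refl => exact Or.inl .refl
  | @tail b c _ hbc ih =>
    rw [graph, SimpleGraph.fromRel_adj] at hbc
    rcases hbc.2 with hr | hr <;> rcases ih with ih | ih
    · exact Or.inl (ih.tail hr)
    · rcases ih.cases_head with rfl | ⟨d, hd, hdx⟩
      · exact Or.inl (.single hr)
      · obtain rfl := right_unique hr hd
        exact Or.inr hdx
    · rcases ih.cases_tail with rfl | ⟨d, hxd, hd⟩
      · exact Or.inr (.single hr)
      · obtain rfl := left_unique hr hd
        exact Or.inl hxd
    · exact Or.inr (ih.head hr)

theorem eq_of_reachable {x y : Fin n} (h : lam.graph.Reachable x y)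
    (hx : ¬ ∃ i, (i, x) ∈ lam.arcs) (hy : ¬ ∃ i, (i, y) ∈ lam.arcs) : x = y := by
  rcases chain_of_reachable h with h | h
  · rcases h.cases_tail with h | ⟨d, _, hd⟩
    · exact h.symm
    · exact absurd ⟨d, hd⟩ hy
  · rcases h.cases_tail with h | ⟨d, _, hd⟩
    · exact h
    · exact absurd ⟨d, hd⟩ hx

theorem reachable_max (j : Fin n) : lam.graph.Reachable j
    ((lam.component j).max' ⟨j, lam.self_mem_component j⟩) := by
  have := (lam.component j).max'_mem ⟨j, lam.self_mem_component j⟩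
  simpa [component] using this

theorem qFun_ne {i j j' : Fin n} (h : (i, j) ∈ lam.arcs) (h' : ¬ ∃ i, (i, j') ∈ lam.arcs) :
    lam.qFun j' ≠ i := by
  intro he
  rw [qFun_of_not h'] at he
  have hr : lam.graph.Reachable j' i := he ▸ reachable_max j'
  have hj : j ∈ lam.component j' := by
    simpa [component] using hr.trans (adj_of_mem h).reachable
  have := (lam.component j').le_max' j hj
  rw [he] at this
  exact absurd (lam.lt_of_mem h) (not_lt.mpr this)

theorem qFun_injective : Function.Injective lam.qFun := by
  intro a b hab
  by_cases ha : ∃ i, (i, a) ∈ lam.arcs <;> by_cases hb : ∃ i, (i, b) ∈ lam.arcs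
  · obtain ⟨i, hi⟩ := ha
    obtain ⟨i', hi'⟩ := hb
    rw [qFun_of_mem hi, qFun_of_mem hi'] at hab
    subst hab
    exact right_unique hi hi'
  · obtain ⟨i, hi⟩ := ha
    rw [qFun_of_mem hi] at hab
    exact absurd hab.symm (qFun_ne hi hb)
  · obtain ⟨i, hi⟩ := hb
    rw [qFun_of_mem hi] at hab
    exact absurd hab (qFun_ne hi ha)
  · rw [qFun_of_not ha, qFun_of_not hb] at hab
    have h1 := reachable_max (lam := lam) a
    rw [hab] at h1
    exact eq_of_reachable (h1.trans (reachable_max b).symm) ha hb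

variable (lam)

/-- The permutation `Q_λ` of the noncrossing partition `λ`. -/
noncomputable def Q : Equiv.Perm (Fin n) :=
  Equiv.ofBijective lam.qFun (Finite.injective_iff_bijective.mp qFun_injective)

end NCP

/-- The set `QSV_n` of permutations. -/
def QSV (n : ℕ) : Set (Equiv.Perm (Fin n)) := Set.range NCP.Q

/-- The point `(σ_1, …, σ_n)` of `ℚⁿ`; the values are shifted by one since `Fin n` starts
at `0`. -/
def point {n : ℕ} (σ : Equiv.Perm (Fin n)) : Fin n → ℚ := fun j => ((σ j : ℕ) : ℚ) + 1

/-- The vanishing ideal in `ℚ[x_1, …, x_n]` of the points of `QSV_n`. -/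
noncomputable def idealQSV (n : ℕ) : Ideal (MvPolynomial (Fin n) ℚ) :=
  MvPolynomial.vanishingIdeal ℚ (point '' QSV n)

/-- A polynomial is quasisymmetric if for all positive exponents `a_1, …, a_k` and all
`i_1 < ⋯ < i_k` and `i'_1 < ⋯ < i'_k`, the monomials `x_{i_1}^{a_1} ⋯ x_{i_k}^{a_k}` and
`x_{i'_1}^{a_1} ⋯ x_{i'_k}^{a_k}` have the same coefficient. -/
def IsQuasisymmetric {n : ℕ} (f : MvPolynomial (Fin n) ℚ) : Prop :=
  ∀ (k : ℕ) (a : Fin k → ℕ), (∀ s, 0 < a s) → ∀ i i' : Fin k ↪o Fin n,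
    f.coeff (∑ s, Finsupp.single (i s) (a s)) = f.coeff (∑ s, Finsupp.single (i' s) (a s))

/-- The ideal generated by the quasisymmetric polynomials without constant term. -/
noncomputable def idealQSymPlus (n : ℕ) : Ideal (MvPolynomial (Fin n) ℚ) :=
  Ideal.span {f | IsQuasisymmetric f ∧ MvPolynomial.constantCoeff f = 0}

end QuasisymmetricVariety

/-! Both quotients have dimension `catalan n`, so they are isomorphic; no map between them is
constructed.

For the vanishing ideal, interpolation shows that the quotient has dimension the number of points.
The permutation determines the arcs (`NCP.mem_arcs_iff`), so the points are as many as the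
noncrossing partitions, and these satisfy the Catalan recurrence (`card_ncSets_succ`).

For the quasisymmetric ideal, the subdiagonal monomials, those with every tail sum from the 0-based
position `i` on less than `n - i`, form a basis of the quotient. They are counted by ballot numbers
(`card_subDiag_add_choose`).

They span: each other monomial is congruent to a combination of monomials that are smaller in the
lexicographic order with the last variable most significant. This follows from a family of products
of monomials with fundamental quasisymmetric polynomials in fewer and fewer variables
(`monomial_mul_fundamental_mem_modLex`).

They are independent: let `R_i` set `x_i` to zero and renumber. The divided differences `(R_(i+1) -
R_i) / x_i` carry the ideal in `n + 1` variables into the ideal in `n` variables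
(`exists_dropVar_sub_eq`) and preserve subdiagonal support (`SubDiag.of_succAbove`). By induction on
`n` they kill every subdiagonal element of the ideal. Such an element is constant
(`coeff_eq_zero_of_dropVar_eq`), hence zero. -/

namespace QuasisymmetricVariety

/-! ### Subdiagonal exponents and ballot numbers -/

/-- The sums of the trailing entries of `w`, starting at position `i`, are less than
`n + s - i`. -/
def SubDiag (n s : ℕ) (w : Fin n → ℕ) : Prop :=
  ∀ i : Fin n, (∑ l, if i ≤ l then w l else 0) + i < n + s

/-- A last entry `c` enters every tail sum, so it uses up `c` of the slack, while shortening the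
sequence gives back 1. The bound `c ≤ s` keeps the subtraction from truncating. -/
theorem subDiag_snoc {n s : ℕ} (w : Fin n → ℕ) (c : ℕ) :
    SubDiag (n + 1) s (Fin.snoc w c : Fin (n + 1) → ℕ) ↔ c ≤ s ∧ SubDiag n (s + 1 - c) w := by
  have h1 : ∀ i : Fin n, (∑ l, if i.castSucc ≤ l then (Fin.snoc w c : Fin (n + 1) → ℕ) l else 0) =
      (∑ l, if i ≤ l then w l else 0) + c := by
    intro i
    rw [Fin.sum_univ_castSucc]
    simp [Fin.le_last]
  have h2 : (∑ l, if Fin.last n ≤ l then (Fin.snoc w c : Fin (n + 1) → ℕ) l else 0) = c := by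
    rw [Fin.sum_univ_castSucc]
    simp [Fin.last_le_iff]
  constructor
  · intro h
    have hl := h (Fin.last n)
    rw [h2, Fin.val_last] at hl
    refine ⟨by omega, fun i => ?_⟩
    have hi := h i.castSucc
    rw [h1, Fin.val_castSucc] at hi
    omega
  · rintro ⟨hc, h⟩ i
    induction i using Fin.lastCases with
    | last => rw [h2, Fin.val_last]; omega
    | cast i =>
      have hi := h i
      rw [h1, Fin.val_castSucc]
      omega

/-- Splitting off the last entry of a subdiagonal sequence. -/
def subDiagSuccEquiv (n s : ℕ) :
    {w // SubDiag (n + 1) s w} ≃ Σ c : Fin (s + 1), {w // SubDiag n (s + 1 - c) w} where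
  toFun w :=
    have h : w.1 (Fin.last n) ≤ s ∧ SubDiag n (s + 1 - w.1 (Fin.last n)) (Fin.init w.1) := by
      rw [← subDiag_snoc, Fin.snoc_init_self]; exact w.2
    ⟨⟨w.1 (Fin.last n), by omega⟩, Fin.init w.1, h.2⟩
  invFun p := ⟨Fin.snoc p.2.1 p.1, (subDiag_snoc _ _).2 ⟨by omega, p.2.2⟩⟩
  left_inv w := by simp
  right_inv p := by
    obtain ⟨⟨c, hc⟩, w, hw⟩ := p
    simp only [Sigma.mk.injEq, Fin.snoc_last, true_and]
    congr! 2 <;> simp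

theorem finite_subDiag (n s : ℕ) : Finite {w // SubDiag n s w} := by
  induction n generalizing s with
  | zero => infer_instance
  | succ n ih => exact Finite.of_equiv _ (subDiagSuccEquiv n s).symm

instance instFiniteSubDiag (n s : ℕ) : Finite {w // SubDiag n s w} := finite_subDiag n s

theorem card_subDiag_zero (s : ℕ) : Nat.card {w // SubDiag 0 s w} = 1 := by
  rw [Nat.card_eq_one_iff_unique]
  exact ⟨inferInstance, ⟨⟨Fin.elim0, fun i => i.elim0⟩⟩⟩

theorem card_subDiag_succ (n s : ℕ) : Nat.card {w // SubDiag (n + 1) s w} =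
    ∑ j ∈ Finset.range (s + 1), Nat.card {w // SubDiag n (j + 1) w} := by
  rw [Nat.card_congr (subDiagSuccEquiv n s), Nat.card_sigma,
    Fin.sum_univ_eq_sum_range (fun c => Nat.card {w // SubDiag n (s + 1 - c) w}),
    ← Finset.sum_range_reflect]
  refine Finset.sum_congr rfl fun j hj => ?_
  rw [Finset.mem_range] at hj
  rw [show s + 1 - (s + 1 - 1 - j) = j + 1 by omega]

/-- The ballot number as a difference of binomials, written additively. The recurrence on the last
entry becomes Pascal's rule. -/
theorem card_subDiag_add_choose (n s : ℕ) :
    Nat.card {w // SubDiag (n + 1) s w} + (2 * n + s + 2).choose n =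
      (2 * n + s + 2).choose (n + 1) := by
  induction n generalizing s with
  | zero => simp [card_subDiag_succ, card_subDiag_zero]
  | succ n ih =>
    induction s with
    | zero =>
      rw [card_subDiag_succ, Finset.sum_range_one]
      have h1 := ih 1
      have e1 := Nat.choose_succ_succ (2 * n + 3) n
      have e2 := Nat.choose_succ_succ (2 * n + 3) (n + 1)
      have e3 := Nat.choose_symm_of_eq_add (show 2 * n + 3 = (n + 1) + (n + 2) by ring)
      simp only [Nat.succ_eq_add_one, zero_add, Nat.reduceAdd, add_assoc, mul_add, mul_one,
        add_zero] at *
      omega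
    | succ s ihs =>
      -- Splitting off the top summand leaves exactly the sum for `s`, so the count for `s + 1` is
      -- the count for `s` plus one count of length one less.
      rw [card_subDiag_succ, Finset.sum_range_succ, ← card_subDiag_succ]
      have h1 := ih (s + 1 + 1)
      have e1 := Nat.choose_succ_succ (2 * (n + 1) + s + 2) n
      have e2 := Nat.choose_succ_succ (2 * (n + 1) + s + 2) (n + 1)
      rw [show 2 * n + (s + 1 + 1) + 2 = 2 * (n + 1) + s + 2 by ring] at h1
      rw [show 2 * (n + 1) + (s + 1) + 2 = 2 * (n + 1) + s + 2 + 1 by ring]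
      simp only [Nat.succ_eq_add_one] at e1 e2
      omega

theorem card_subDiag (n : ℕ) : Nat.card {w // SubDiag n 0 w} = catalan n := by
  cases n with
  | zero => rw [card_subDiag_zero, catalan_zero]
  | succ n =>
    have h1 := card_subDiag_add_choose n 0
    have h2 := succ_mul_catalan_eq_centralBinom (n + 1)
    have h4 := Nat.choose_succ_right_eq (2 * n + 2) n
    rw [Nat.centralBinom_eq_two_mul_choose, show 2 * (n + 1) = 2 * n + 2 by ring] at h2
    rw [show 2 * n + 2 - n = n + 2 by omega] at h4
    rw [add_zero] at h1
    apply Nat.eq_of_mul_eq_mul_left (show 0 < n + 1 + 1 by omega)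
    rw [h2]
    nlinarith

/-! ### Counting noncrossing sets of arcs -/

/-- A set of arcs on `ℕ` that is noncrossing in the sense of `NCP`. -/
def IsNC (A : Finset (ℕ × ℕ)) : Prop :=
  (∀ p ∈ A, p.1 < p.2) ∧
    ∀ p ∈ A, ∀ q ∈ A, p ≠ q → ¬ (p.1 ≤ q.1 ∧ q.1 < p.2 ∧ p.2 ≤ q.2)

open Classical in
/-- The noncrossing sets of arcs on the vertices `a, …, a + n - 1`. -/
noncomputable def ncSets (a n : ℕ) : Finset (Finset (ℕ × ℕ)) :=
  ((Finset.Ico a (a + n) ×ˢ Finset.Ico a (a + n)).powerset).filter IsNC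

open Classical in
theorem mem_ncSets {a n : ℕ} {A : Finset (ℕ × ℕ)} :
    A ∈ ncSets a n ↔ (∀ p ∈ A, a ≤ p.1 ∧ p.2 < a + n) ∧ IsNC A := by
  rw [ncSets, Finset.mem_filter, Finset.mem_powerset]
  refine and_congr_left fun hA => ⟨fun h p hp => ?_, fun h p hp => ?_⟩
  · have := h hp
    simp only [Finset.mem_product, Finset.mem_Ico] at this
    omega
  · have h1 := h p hp
    have h2 := hA.1 p hp
    simp only [Finset.mem_product, Finset.mem_Ico]
    omega

/-- The arc joining `a + k - 1` to `a + n`, if `k ≠ 0`. -/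
def lastArc (a n k : ℕ) : Finset (ℕ × ℕ) := if k = 0 then ∅ else {(a + k - 1, a + n)}

theorem mem_lastArc {a n k : ℕ} {p : ℕ × ℕ} :
    p ∈ lastArc a n k ↔ k ≠ 0 ∧ p.1 = a + k - 1 ∧ p.2 = a + n := by
  rw [lastArc]
  split_ifs with h <;> simp [h, Prod.ext_iff]

theorem union_mem_ncSets {a n k : ℕ} (hk : k ≤ n) {A B : Finset (ℕ × ℕ)}
    (hA : A ∈ ncSets a k) (hB : B ∈ ncSets (a + k) (n - k)) :
    A ∪ B ∪ lastArc a n k ∈ ncSets a (n + 1) := by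
  rw [mem_ncSets] at *
  obtain ⟨hA, hA1, hA2⟩ := hA
  obtain ⟨hB, hB1, hB2⟩ := hB
  simp only [IsNC, Finset.mem_union, mem_lastArc]
  refine ⟨?_, ?_, ?_⟩
  · rintro p ((hp | hp) | hp)
    · have := hA p hp; omega
    · have := hB p hp; omega
    · omega
  · rintro p ((hp | hp) | hp)
    · exact hA1 p hp
    · exact hB1 p hp
    · omega
  · rintro p ((hp | hp) | hp) q ((hq | hq) | hq) hpq
    · exact hA2 p hp q hq hpq
    · have := hA p hp; have := hB q hq; omega
    · have := hA p hp; omega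
    · have := hA q hq; have := hB p hp; have := hA1 q hq; omega
    · exact hB2 p hp q hq hpq
    · have := hB p hp; omega
    · have := hA q hq; have := hA1 q hq; omega
    · have := hB q hq; have := hB1 q hq; omega
    · exact absurd (Prod.ext (hp.2.1.trans hq.2.1.symm) (hp.2.2.trans hq.2.2.symm)) hpq

/-- The arc into the last vertex, if present, starts at `a + k - 1`; `k = 0` encodes its absence. No
other arc passes over the gap after `a + k - 1`, so the rest splits into independent sets on the
first `k` and the next `n - k` vertices. This is the Catalan recurrence. -/
theorem card_ncSets_succ (a n : ℕ) : (ncSets a (n + 1)).card =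
    ∑ k ∈ Finset.range (n + 1), (ncSets a k).card * (ncSets (a + k) (n - k)).card := by
  simp_rw [← Finset.card_product]
  rw [← Finset.card_sigma]
  symm
  refine Finset.card_bij (fun x _ => x.2.1 ∪ x.2.2 ∪ lastArc a n x.1) ?_ ?_ ?_
  · rintro ⟨k, A, B⟩ h
    simp only [Finset.mem_sigma, Finset.mem_range, Finset.mem_product] at h
    exact union_mem_ncSets (Nat.lt_succ_iff.1 h.1) h.2.1 h.2.2
  · rintro ⟨k, A, B⟩ h ⟨k', A', B'⟩ h' he
    simp only [Finset.mem_sigma, Finset.mem_range, Finset.mem_product, mem_ncSets] at h h'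
    obtain ⟨hk, ⟨hA, hA1⟩, hB, hB1⟩ := h
    obtain ⟨hk', ⟨hA', hA1'⟩, hB', hB1'⟩ := h'
    simp only [Finset.ext_iff, Finset.mem_union, mem_lastArc] at he
    -- Only the last arc reaches the vertex `a + n`, so a union containing such an arc determines
    -- `k`. The case `k = 0` is excluded here because it has no arc to compare.
    have key : ∀ {l l' : ℕ} {C C' D D' : Finset (ℕ × ℕ)}, l < n + 1 → l' < n + 1 →
        (∀ p ∈ C', a ≤ p.1 ∧ p.2 < a + l') →
        (∀ p ∈ D', a + l' ≤ p.1 ∧ p.2 < a + l' + (n - l')) →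
        (∀ p : ℕ × ℕ, ((p ∈ C ∨ p ∈ D) ∨ l ≠ 0 ∧ p.1 = a + l - 1 ∧ p.2 = a + n) ↔
          ((p ∈ C' ∨ p ∈ D') ∨ l' ≠ 0 ∧ p.1 = a + l' - 1 ∧ p.2 = a + n)) →
        l ≠ 0 → l = l' := by
      intro l l' C C' D D' hl hl' hC' hD' he hl0
      rcases (he (a + l - 1, a + n)).1 (Or.inr ⟨hl0, rfl, rfl⟩) with (h | h) | h
      · have := hC' _ h; simp only at this; omega
      · have := hD' _ h; simp only at this; omega
      · simp only at h; omega
    have hkk : k = k' := by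
      by_cases h0 : k = 0
      · by_cases h0' : k' = 0
        · omega
        · exact (key hk' hk hA hB (fun p => (he p).symm) h0').symm
      · exact key hk hk' hA' hB' he h0
    subst hkk
    have hAA : A = A' := by
      ext p
      constructor <;> intro hp
      · rcases (he p).1 (Or.inl (Or.inl hp)) with (h | h) | h
        · exact h
        · have := hA _ hp; have := hA1.1 _ hp; have := hB' _ h; omega
        · have := hA _ hp; omega
      · rcases (he p).2 (Or.inl (Or.inl hp)) with (h | h) | h
        · exact h
        · have := hA' _ hp; have := hA1'.1 _ hp; have := hB _ h; omega
        · have := hA' _ hp; omega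
    have hBB : B = B' := by
      ext p
      constructor <;> intro hp
      · rcases (he p).1 (Or.inl (Or.inr hp)) with (h | h) | h
        · have := hB _ hp; have := hB1.1 _ hp; have := hA' _ h; omega
        · exact h
        · have := hB _ hp; omega
      · rcases (he p).2 (Or.inl (Or.inr hp)) with (h | h) | h
        · have := hB' _ hp; have := hB1'.1 _ hp; have := hA _ h; omega
        · exact h
        · have := hB' _ hp; omega
    rw [hAA, hBB]
  · intro C hC
    rw [mem_ncSets] at hC
    obtain ⟨hC, hC1, hC2⟩ := hC
    have sub : ∀ D ⊆ C, IsNC D := fun D hD =>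
      ⟨fun p hp => hC1 p (hD hp), fun p hp q hq => hC2 p (hD hp) q (hD hq)⟩
    obtain ⟨k, hk, hlast, hsplit⟩ : ∃ k ≤ n, (∀ p, p ∈ lastArc a n k ↔ p ∈ C ∧ p.2 = a + n) ∧
        ∀ p ∈ C, p.2 < a + n → p.2 < a + k ∨ a + k ≤ p.1 := by
      by_cases h : ∃ i, (i, a + n) ∈ C
      · obtain ⟨i, hi⟩ := h
        have h1 := hC _ hi
        have h2 := hC1 _ hi
        simp only at h1 h2
        -- An arc that starts at or before `i` and ends after `i` crosses the arc into the last
        -- vertex, or shares an endpoint with it in a forbidden way.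
        have hx : ∀ p ∈ C, i < p.2 → p.1 ≤ i → p = (i, a + n) := by
          intro p hp hlt hle
          by_contra hne
          have := hC p hp
          exact hC2 p hp _ hi hne ⟨hle, hlt, by simp only; omega⟩
        refine ⟨i + 1 - a, by omega, fun p => ?_, fun p hp hlt => ?_⟩
        · rw [mem_lastArc]
          constructor
          · intro hp
            have : p = (i, a + n) := Prod.ext (by simp only; omega) hp.2.2
            subst this
            exact ⟨hi, rfl⟩
          · rintro ⟨hp, hp2⟩
            have : p = (i, a + n) := by
              by_contra hne
              have hp' := hC1 p hp
              rcases le_total p.1 i with hle | hle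
              · exact hne (hx p hp (by omega) hle)
              · exact hC2 _ hi p hp (Ne.symm hne) ⟨hle, by simp only; omega, by simp only; omega⟩
            subst this
            simp only [and_true]
            omega
        · by_contra! hcon
          have := hx p hp (by omega) (by omega)
          subst this
          simp only at hlt
          omega
      · refine ⟨0, by omega, fun p => ?_, fun p hp _ => Or.inr (hC p hp).1⟩
        rw [mem_lastArc]
        simp only [ne_eq, not_true_eq_false, false_and, false_iff]
        rintro ⟨hp, hp2⟩
        exact h ⟨p.1, hp2 ▸ hp⟩
    refine ⟨⟨k, C.filter (fun p => p.2 < a + k),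
      C.filter (fun p => a + k ≤ p.1 ∧ p.2 < a + n)⟩, ?_, ?_⟩
    · simp only [Finset.mem_sigma, Finset.mem_range, Finset.mem_product, mem_ncSets]
      refine ⟨by omega, ⟨fun p hp => ?_, sub _ (Finset.filter_subset _ _)⟩, fun p hp => ?_,
        sub _ (Finset.filter_subset _ _)⟩
      · rw [Finset.mem_filter] at hp
        exact ⟨(hC p hp.1).1, hp.2⟩
      · rw [Finset.mem_filter] at hp
        omega
    · ext p
      simp only [Finset.mem_union, Finset.mem_filter, hlast]
      constructor
      · tauto
      · intro hp
        have h1 := hC p hp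
        rcases lt_or_eq_of_le (show p.2 ≤ a + n by omega) with h | h
        · rcases hsplit p hp h with h' | h' <;> tauto
        · tauto

theorem card_ncSets (a n : ℕ) : (ncSets a n).card = catalan n := by
  induction n using Nat.strong_induction_on generalizing a with
  | _ n ih =>
    cases n with
    | zero =>
      rw [catalan_zero, Finset.card_eq_one]
      refine ⟨∅, ?_⟩
      ext A
      rw [mem_ncSets, Finset.mem_singleton]
      constructor
      · rintro ⟨h, h1, _⟩
        refine Finset.eq_empty_of_forall_notMem fun p hp => ?_
        have := h p hp
        have := h1 p hp
        omega
      · rintro rfl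
        simp [IsNC]
    | succ n =>
      rw [card_ncSets_succ, catalan_succ,
        Fin.sum_univ_eq_sum_range (fun k => catalan k * catalan (n - k))]
      refine Finset.sum_congr rfl fun k hk => ?_
      rw [Finset.mem_range] at hk
      rw [ih k (by omega), ih (n - k) (by omega)]

/-! ### The points of `QSV n` -/

namespace NCP

theorem arcs_injective (n : ℕ) : Function.Injective (NCP.arcs : NCP n → _) := by
  rintro ⟨A, _, _⟩ ⟨B, _, _⟩ rfl
  rfl

/-- The inclusion of arcs on `Fin n` into arcs on `ℕ`. -/
def arcEmb (n : ℕ) : Fin n × Fin n ↪ ℕ × ℕ := Fin.valEmbedding.prodMap Fin.valEmbedding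

theorem mem_map_arcEmb {n : ℕ} {A : Finset (Fin n × Fin n)} {p : ℕ × ℕ} :
    p ∈ A.map (arcEmb n) ↔ ∃ i j : Fin n, (i, j) ∈ A ∧ p = ((i : ℕ), (j : ℕ)) := by
  simp only [Finset.mem_map, Prod.exists, arcEmb, Function.Embedding.coe_prodMap, Prod.map,
    Fin.valEmbedding_apply, eq_comm]

/-- Noncrossing partitions as noncrossing sets of arcs on `0, …, n - 1`. -/
noncomputable def equivNcSets (n : ℕ) : NCP n ≃ ncSets 0 n := by
  refine Equiv.ofBijective (fun lam => ⟨lam.arcs.map (arcEmb n), ?_⟩) ⟨?_, ?_⟩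
  · rw [mem_ncSets]
    refine ⟨fun p hp => ?_, fun p hp => ?_, fun p hp q hq hpq => ?_⟩
    · obtain ⟨i, j, _, rfl⟩ := mem_map_arcEmb.1 hp
      simp
    · obtain ⟨i, j, h, rfl⟩ := mem_map_arcEmb.1 hp
      exact lam.lt_of_mem h
    · obtain ⟨i, k, h, rfl⟩ := mem_map_arcEmb.1 hp
      obtain ⟨j, l, h', rfl⟩ := mem_map_arcEmb.1 hq
      exact lam.noncrossing h h' (by rintro ⟨⟩; exact hpq rfl)
  · intro lam mu h
    exact arcs_injective n (Finset.map_injective _ (congrArg Subtype.val h))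
  · rintro ⟨C, hC⟩
    rw [mem_ncSets] at hC
    obtain ⟨hC, hC1, hC2⟩ := hC
    refine ⟨⟨Finset.univ.filter fun p => ((p.1 : ℕ), (p.2 : ℕ)) ∈ C, ?_, ?_⟩, ?_⟩
    · intro i j h
      exact hC1 _ (Finset.mem_filter.1 h).2
    · intro i j k l h h' hne
      refine hC2 _ (Finset.mem_filter.1 h).2 _ (Finset.mem_filter.1 h').2 fun he => hne ?_
      simpa [Prod.ext_iff, Fin.ext_iff] using he
    · ext p
      rw [mem_map_arcEmb]
      constructor
      · rintro ⟨i, j, h, rfl⟩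
        exact (Finset.mem_filter.1 h).2
      · intro hp
        have h1 := hC p hp
        have h2 := hC1 p hp
        exact ⟨⟨p.1, by omega⟩, ⟨p.2, by omega⟩, Finset.mem_filter.2 ⟨Finset.mem_univ _, hp⟩, rfl⟩

theorem card_eq_catalan (n : ℕ) : Nat.card (NCP n) = catalan n := by
  rw [Nat.card_congr (equivNcSets n), Nat.card_eq_fintype_card, Fintype.card_coe, card_ncSets]

instance instFinite (n : ℕ) : Finite (NCP n) := Finite.of_equiv _ (equivNcSets n).symm

theorem Q_apply {n : ℕ} (lam : NCP n) (j : Fin n) : lam.Q j = lam.qFun j := rfl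

/-- A vertex that is not a right endpoint is sent to the maximum of its component, hence never to a
smaller vertex. The arcs are therefore the strict descents `Q j < j`. -/
theorem mem_arcs_iff {n : ℕ} (lam : NCP n) (i j : Fin n) :
    (i, j) ∈ lam.arcs ↔ lam.Q j = i ∧ i < j := by
  rw [Q_apply]
  constructor
  · intro h
    exact ⟨qFun_of_mem h, lam.lt_of_mem h⟩
  · rintro ⟨h, hlt⟩
    by_cases hex : ∃ i, (i, j) ∈ lam.arcs
    · obtain ⟨i', hi'⟩ := hex
      rwa [← h, qFun_of_mem hi']
    · rw [qFun_of_not hex] at h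
      have := (lam.component j).le_max' j (lam.self_mem_component j)
      rw [h] at this
      exact absurd hlt (not_lt.2 this)

theorem Q_injective (n : ℕ) : Function.Injective (NCP.Q : NCP n → _) := by
  intro lam mu h
  apply arcs_injective
  ext ⟨i, j⟩
  rw [mem_arcs_iff, mem_arcs_iff, h]

end NCP

theorem point_injective (n : ℕ) : Function.Injective (point : Equiv.Perm (Fin n) → _) := by
  intro σ τ h
  ext j
  simpa [point] using congrFun h j

theorem finite_point_image_QSV (n : ℕ) : (point '' QSV n).Finite :=
  (Set.finite_range _).image _

theorem card_point_image_QSV (n : ℕ) : Nat.card (point '' QSV n : Set (Fin n → ℚ)) = catalan n := by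
  rw [QSV, ← Set.range_comp,
    Nat.card_range_of_injective ((point_injective n).comp (NCP.Q_injective n)),
    NCP.card_eq_catalan]

/-! ### Interpolation at finitely many points -/

open MvPolynomial

/-- Evaluation of polynomials at the points of a set. -/
noncomputable def evalOn {σ K : Type*} [Field K] (V : Set (σ → K)) :
    MvPolynomial σ K →ₐ[K] (V → K) :=
  AlgHom.pi fun v => aeval v.1

theorem evalOn_apply {σ K : Type*} [Field K] (V : Set (σ → K)) (p : MvPolynomial σ K) (v : V) :
    evalOn V p v = aeval v.1 p := rfl

theorem ker_evalOn {σ K : Type*} [Field K] (V : Set (σ → K)) :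
    RingHom.ker (evalOn V) = vanishingIdeal K V := by
  ext p
  rw [RingHom.mem_ker, mem_vanishingIdeal_iff, funext_iff, Subtype.forall]
  rfl

/-- Lagrange interpolation: for each other point `u`, take a linear factor in a coordinate where `u`
and `v` differ, and multiply these factors. -/
theorem exists_evalOn_eq_single {σ K : Type*} [Field K] (V : Set (σ → K)) [Fintype V]
    [DecidableEq V] (v : V) : ∃ p, evalOn V p = Pi.single v 1 := by
  have h : ∀ u : V, ∃ p : MvPolynomial σ K, aeval v.1 p = (1 : K) ∧
      (u ≠ v → aeval u.1 p = (0 : K)) := by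
    intro u
    by_cases huv : u = v
    · exact ⟨1, map_one _, fun h => absurd huv h⟩
    · obtain ⟨i, hi⟩ := Function.ne_iff.1 fun h => huv (Subtype.ext h)
      refine ⟨C ((v.1 i - u.1 i)⁻¹) * (X i - C (u.1 i)), ?_, fun _ => ?_⟩
      · simp [inv_mul_cancel₀ (sub_ne_zero.2 (Ne.symm hi))]
      · simp
  choose p hp1 hp0 using h
  refine ⟨∏ u, p u, ?_⟩
  ext u
  rw [evalOn_apply, map_prod]
  by_cases huv : u = v
  · subst huv
    rw [Pi.single_eq_same]
    exact Finset.prod_eq_one fun u' _ => hp1 u'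
  · rw [Pi.single_eq_of_ne huv]
    exact Finset.prod_eq_zero (Finset.mem_univ u) (hp0 u huv)

theorem evalOn_surjective {σ K : Type*} [Field K] (V : Set (σ → K)) [Finite V] :
    Function.Surjective (evalOn V) := by
  classical
  have := Fintype.ofFinite V
  intro g
  choose p hp using exists_evalOn_eq_single V
  refine ⟨∑ v, g v • p v, ?_⟩
  ext u
  simp [map_sum, map_smul, hp, Finset.sum_apply, Pi.single_apply]

theorem rank_quotient_vanishingIdeal {σ K : Type} [Field K] (V : Set (σ → K)) [Finite V] :
    Module.rank K (MvPolynomial σ K ⧸ vanishingIdeal K V) = (Nat.card V : Cardinal) := by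
  have := Fintype.ofFinite V
  rw [← ker_evalOn, (Ideal.quotientKerAlgEquivOfSurjective
    (evalOn_surjective V)).toLinearEquiv.rank_eq, rank_fun', Nat.card_eq_fintype_card]

/-! ### Deleting a variable -/

/-- Setting the `i`-th variable to zero and renumbering the remaining ones. -/
noncomputable def dropVar {n : ℕ} (i : Fin (n + 1)) :
    MvPolynomial (Fin (n + 1)) ℚ →ₐ[ℚ] MvPolynomial (Fin n) ℚ :=
  killCompl (Fin.succAbove_right_injective (p := i))

theorem coeff_dropVar {n : ℕ} (i : Fin (n + 1)) (f : MvPolynomial (Fin (n + 1)) ℚ)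
    (m : Fin n →₀ ℕ) : (dropVar i f).coeff m = f.coeff (m.mapDomain i.succAbove) :=
  coeff_killCompl _

theorem dropVar_X_self {n : ℕ} (i : Fin (n + 1)) : dropVar i (X i) = 0 := by
  rw [dropVar, killCompl, aeval_X, dif_neg]
  rintro ⟨j, hj⟩
  exact Fin.succAbove_ne i j hj

theorem dropVar_X_succAbove {n : ℕ} (i : Fin (n + 1)) (j : Fin n) :
    dropVar i (X (i.succAbove j)) = X j := by
  rw [dropVar, ← rename_X, killCompl_rename_app]

theorem exists_succAbove_comp {n k : ℕ} (p : Fin (n + 1)) (i : Fin k ↪o Fin (n + 1))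
    (hp : p ∉ Set.range i) : ∃ t : Fin k ↪o Fin n, ∀ s, p.succAbove (t s) = i s := by
  have h : ∀ s, ∃ t, p.succAbove t = i s := fun s =>
    Fin.exists_succAbove_eq fun he => hp ⟨s, he⟩
  choose t ht using h
  refine ⟨OrderEmbedding.ofStrictMono t fun a b hab => ?_, ht⟩
  rw [← (Fin.strictMono_succAbove p).lt_iff_lt, ht, ht]
  exact i.strictMono hab

theorem mapDomain_sum_single {n k : ℕ} (p : Fin (n + 1)) (i : Fin k → Fin n) (a : Fin k → ℕ) :
    (∑ s, Finsupp.single (i s) (a s)).mapDomain p.succAbove =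
      ∑ s, Finsupp.single (p.succAbove (i s)) (a s) := by
  simp [Finsupp.mapDomain_finsetSum, Finsupp.mapDomain_single]

/-- A monomial that misses some variable has its coefficient read off in `g`, whichever missing
variable is deleted. Monomials involving all variables impose no condition, as only one increasing
sequence of indices has full length. -/
theorem isQuasisymmetric_of_dropVar {n : ℕ} {f : MvPolynomial (Fin (n + 1)) ℚ}
    {g : MvPolynomial (Fin n) ℚ} (hg : IsQuasisymmetric g) (h : ∀ i, dropVar i f = g) :
    IsQuasisymmetric f := by
  intro k a ha i i'
  by_cases hk : k = n + 1
  · subst hk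
    have he := Subsingleton.elim
      (RelIso.ofSurjective i (Finite.surjective_of_injective i.injective))
      (RelIso.ofSurjective i' (Finite.surjective_of_injective i'.injective))
    have he' : ∀ s, i s = i' s := fun s => congrArg (fun e => e s) he
    simp_rw [he']
  · have hns : ∀ i : Fin k ↪o Fin (n + 1), ∃ p, p ∉ Set.range i := by
      intro i
      by_contra! hcon
      have hb : Function.Bijective i := ⟨i.injective, hcon⟩
      exact hk (by simpa using Fintype.card_of_bijective hb)
    have key : ∀ i : Fin k ↪o Fin (n + 1), ∃ t : Fin k ↪o Fin n,
        f.coeff (∑ s, Finsupp.single (i s) (a s)) = g.coeff (∑ s, Finsupp.single (t s) (a s)) := by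
      intro i
      obtain ⟨p, hp⟩ := hns i
      obtain ⟨t, ht⟩ := exists_succAbove_comp p i hp
      refine ⟨t, ?_⟩
      rw [← h p, coeff_dropVar, mapDomain_sum_single]
      simp_rw [ht]
    obtain ⟨t, ht⟩ := key i
    obtain ⟨t', ht'⟩ := key i'
    rw [ht, ht', hg k a ha t t']

/-! ### Fundamental quasisymmetric polynomials -/

/-- The variable with number `j`, or zero if there is none. -/
noncomputable def var (n j : ℕ) : MvPolynomial (Fin n) ℚ :=
  if h : j < n then X ⟨j, h⟩ else 0

theorem var_of_lt {n j : ℕ} (h : j < n) : var n j = X ⟨j, h⟩ := dif_pos h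

theorem dropVar_var {n j : ℕ} (i : Fin (n + 1)) (hj : j < n + 1) : dropVar i (var (n + 1) j) =
    if j < i then var n j else if j = i then 0 else var n (j - 1) := by
  rw [var_of_lt hj]
  split_ifs with h1 h2
  · have : (⟨j, hj⟩ : Fin (n + 1)) = i.succAbove ⟨j, by omega⟩ := by
      rw [Fin.succAbove_of_castSucc_lt]
      · rfl
      · simpa [Fin.lt_def] using h1
    rw [this, dropVar_X_succAbove, var_of_lt]
  · have : (⟨j, hj⟩ : Fin (n + 1)) = i := Fin.ext h2
    rw [this, dropVar_X_self]
  · have : (⟨j, hj⟩ : Fin (n + 1)) = i.succAbove ⟨j - 1, by omega⟩ := by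
      rw [Fin.succAbove_of_le_castSucc]
      · ext; simp only [Fin.succ_mk]; omega
      · simp only [Fin.le_def, Fin.castSucc_mk]; omega
    rw [this, dropVar_X_succAbove, var_of_lt]

/-- The fundamental quasisymmetric polynomials in the first `j` of `n` variables, taken in
decreasing order. -/
noncomputable def fundamental (n : ℕ) : ℕ → List ℕ → MvPolynomial (Fin n) ℚ
  | _, [] => 1
  | 0, _ :: _ => 0
  | j + 1, a :: β => ∑ c ∈ Finset.range a, var n j ^ c * fundamental n j ((a - c) :: β) +
      var n j ^ a * fundamental n j β

theorem fundamental_nil (n j : ℕ) : fundamental n j [] = 1 := by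
  cases j <;> rfl

theorem fundamental_succ_cons (n j a : ℕ) (β : List ℕ) : fundamental n (j + 1) (a :: β) =
    ∑ c ∈ Finset.range a, var n j ^ c * fundamental n j ((a - c) :: β) +
      var n j ^ a * fundamental n j β := rfl

theorem fundamental_succ_zero_cons (n j : ℕ) (β : List ℕ) :
    fundamental n (j + 1) (0 :: β) = fundamental n j β := by
  simp [fundamental_succ_cons]

/-- Peels off one factor `x_j`. Allowing a zero first part makes this hold for `a = 0` too, where
the last factor is `fundamental n j β`. -/
theorem fundamental_succ_succ_cons (n j a : ℕ) (β : List ℕ) :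
    fundamental n (j + 1) ((a + 1) :: β) =
      fundamental n j ((a + 1) :: β) + var n j * fundamental n (j + 1) (a :: β) := by
  rw [fundamental_succ_cons, fundamental_succ_cons, Finset.sum_range_succ', mul_add,
    Finset.mul_sum]
  simp only [Nat.add_sub_add_right, pow_succ', mul_assoc, pow_zero, one_mul, Nat.sub_zero]
  ring

theorem map_fundamental_succ_of_var_eq_zero {n j : ℕ} {B : Type*} [CommRing B]
    (φ : MvPolynomial (Fin n) ℚ →+* B) (h : φ (var n j) = 0) {β : List ℕ}
    (hβ : ∀ a ∈ β, 0 < a) : φ (fundamental n (j + 1) β) = φ (fundamental n j β) := by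
  cases β with
  | nil => rw [fundamental_nil, fundamental_nil]
  | cons a β =>
    obtain ⟨a, rfl⟩ := Nat.exists_eq_add_of_lt (hβ a List.mem_cons_self)
    rw [zero_add, fundamental_succ_succ_cons, map_add, map_mul, h, zero_mul, add_zero]

theorem constantCoeff_fundamental (n j : ℕ) {β : List ℕ} (hβ : ∀ a ∈ β, 0 < a) (h : β ≠ []) :
    constantCoeff (fundamental n j β) = 0 := by
  induction j with
  | zero =>
    cases β with
    | nil => exact absurd rfl h
    | cons a β => rw [fundamental, map_zero]
  | succ j ih =>
    rw [map_fundamental_succ_of_var_eq_zero _ _ hβ, ih]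
    rw [var]
    split_ifs <;> simp

/-- Deleting one of the first `j` variables leaves the same fundamental polynomial in `j - 1`
variables; deleting a later one changes nothing. With `j = n + 1` this feeds the criterion
`isQuasisymmetric_of_dropVar`. -/
theorem dropVar_fundamental {n : ℕ} (i : Fin (n + 1)) {j : ℕ} (hj : j ≤ n + 1) {β : List ℕ}
    (hβ : ∀ a ∈ β, 0 < a) : dropVar i (fundamental (n + 1) j β) =
      fundamental n (if j ≤ i then j else j - 1) β := by
  induction j generalizing β with
  | zero =>
    cases β with
    | nil => simp [fundamental_nil]
    | cons a β => simp [fundamental]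
  | succ j ih =>
    have hv := dropVar_var i (show j < n + 1 by omega)
    rcases lt_trichotomy j i with h | h | h
    · rw [if_pos h] at hv
      rw [if_pos (by omega)]
      cases β with
      | nil => simp [fundamental_nil]
      | cons a β =>
        rw [fundamental_succ_cons, fundamental_succ_cons, map_add, map_sum, map_mul, map_pow, hv,
          ih (by omega) fun b hb => hβ b (List.mem_cons_of_mem _ hb), if_pos h.le]
        congr 1
        refine Finset.sum_congr rfl fun c hc => ?_
        rw [map_mul, map_pow, hv, ih (by omega), if_pos h.le]
        intro b hb
        rcases List.mem_cons.1 hb with rfl | hb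
        · rw [Finset.mem_range] at hc; omega
        · exact hβ b (List.mem_cons_of_mem _ hb)
    · rw [if_neg (by omega), if_pos h] at hv
      have h1 := map_fundamental_succ_of_var_eq_zero (dropVar i).toRingHom hv hβ
      have h2 := ih (by omega) hβ
      rw [if_pos h.le] at h2
      rw [if_neg (by omega), Nat.add_sub_cancel, ← h2]
      exact h1
    · rw [if_neg (by omega), if_neg (by omega)] at hv
      rw [if_neg (by omega)]
      obtain ⟨k, rfl⟩ : ∃ k, j = k + 1 := ⟨j - 1, by omega⟩
      simp only [Nat.add_sub_cancel] at hv ih ⊢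
      cases β with
      | nil => simp [fundamental_nil]
      | cons a β =>
        rw [fundamental_succ_cons, fundamental_succ_cons n, map_add, map_sum, map_mul, map_pow, hv,
          ih (by omega) fun b hb => hβ b (List.mem_cons_of_mem _ hb), if_neg (by omega)]
        congr 1
        refine Finset.sum_congr rfl fun c hc => ?_
        rw [map_mul, map_pow, hv, ih (by omega), if_neg (by omega)]
        intro b hb
        rcases List.mem_cons.1 hb with rfl | hb
        · rw [Finset.mem_range] at hc; omega
        · exact hβ b (List.mem_cons_of_mem _ hb)

theorem isQuasisymmetric_fundamental (n : ℕ) {β : List ℕ} (hβ : ∀ a ∈ β, 0 < a) :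
    IsQuasisymmetric (fundamental n n β) := by
  induction n with
  | zero =>
    intro k a _ i i'
    congr 2
    ext s
    exact (i s).elim0
  | succ n ih =>
    refine isQuasisymmetric_of_dropVar ih fun i => ?_
    rw [dropVar_fundamental i le_rfl hβ, if_neg (by omega), Nat.add_sub_cancel]

theorem fundamental_mem_idealQSymPlus (n : ℕ) {β : List ℕ} (hβ : ∀ a ∈ β, 0 < a) (h : β ≠ []) :
    fundamental n n β ∈ idealQSymPlus n :=
  Ideal.subset_span ⟨isQuasisymmetric_fundamental n hβ, constantCoeff_fundamental n n hβ h⟩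

theorem fundamental_mem_supported (n j : ℕ) (β : List ℕ) :
    fundamental n j β ∈ supported ℚ {l : Fin n | (l : ℕ) < j} := by
  induction j generalizing β with
  | zero =>
    cases β with
    | nil => rw [fundamental_nil]; exact (supported ℚ _).one_mem
    | cons a β => rw [fundamental]; exact (supported ℚ _).zero_mem
  | succ j ih =>
    have hv : var n j ∈ supported ℚ {l : Fin n | (l : ℕ) < j + 1} := by
      rw [var]
      split_ifs with h
      · exact X_mem_supported.2 (show j < j + 1 from Nat.lt_succ_self j)
      · exact (supported ℚ _).zero_mem
    have ih' : ∀ β, fundamental n j β ∈ supported ℚ {l : Fin n | (l : ℕ) < j + 1} := fun β =>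
      supported_mono (Set.ofPred_subset_ofPred.2 fun l hl => Nat.lt_succ_of_lt hl) (ih β)
    cases β with
    | nil => rw [fundamental_nil]; exact (supported ℚ _).one_mem
    | cons a β =>
      rw [fundamental_succ_cons]
      exact add_mem (sum_mem fun c _ => mul_mem (pow_mem hv c) (ih' _))
        (mul_mem (pow_mem hv a) (ih' _))

/-! ### Subdiagonal monomials span the quotient -/

/-- The lexicographic comparison of exponents at the positions `≥ j`, the last position being the
most significant one. -/
def LexBelow {n : ℕ} (j : ℕ) (m w : Fin n →₀ ℕ) : Prop :=
  ∃ i : Fin n, j ≤ i ∧ m i < w i ∧ ∀ l, i < l → m l = w l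

/-- The polynomials whose monomials are smaller than `w` at the positions `≥ j`. -/
noncomputable def lexBelow {n : ℕ} (j : ℕ) (w : Fin n →₀ ℕ) : Submodule ℚ (MvPolynomial (Fin n) ℚ) :=
  restrictSupport ℚ {m | LexBelow j m w}

theorem mul_monomial_mem_lexBelow {n j : ℕ} {w u : Fin n →₀ ℕ} (hu : ∀ l : Fin n, j ≤ l → u l = 0)
    {f : MvPolynomial (Fin n) ℚ} (hf : f ∈ lexBelow j w) : monomial u 1 * f ∈ lexBelow j w := by
  rw [lexBelow, restrictSupport_eq_span] at hf
  induction hf using Submodule.span_induction with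
  | mem x hx =>
    obtain ⟨m, ⟨i, hji, hi, hil⟩, rfl⟩ := hx
    rw [monomial_mul, lexBelow, monomial_mem_restrictSupport]
    refine Or.inl ⟨i, hji, ?_, fun l hl => ?_⟩
    · rwa [Finsupp.add_apply, hu i hji, zero_add]
    · rw [Finsupp.add_apply, hu l (hji.trans hl.le), zero_add, hil l hl]
  | zero => rw [mul_zero]; exact zero_mem _
  | add x y _ _ hx hy => rw [mul_add]; exact add_mem hx hy
  | smul a x _ hx => rw [mul_smul_comm]; exact Submodule.smul_mem _ _ hx

theorem lexBelow_mono {n j j' : ℕ} (hj : j ≤ j') {w w' : Fin n →₀ ℕ}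
    (h : ∀ l : Fin n, j' ≤ l → w' l = w l) : lexBelow j' w' ≤ lexBelow j w := by
  refine restrictSupport_mono ℚ fun m => ?_
  rintro ⟨i, hji, hi, hil⟩
  refine ⟨i, hj.trans hji, (h i hji) ▸ hi, fun l hl => ?_⟩
  rw [hil l hl, h l (hji.trans hl.le)]

theorem monomial_mul_mem_lexBelow {n j : ℕ} {u w : Fin n →₀ ℕ} (h : LexBelow j u w)
    {f : MvPolynomial (Fin n) ℚ} (hf : f ∈ supported ℚ {l : Fin n | (l : ℕ) < j}) :
    monomial u 1 * f ∈ lexBelow j w := by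
  rw [f.as_sum, Finset.mul_sum]
  refine sum_mem fun m hm => ?_
  rw [monomial_mul, lexBelow, monomial_mem_restrictSupport]
  have h0 : ∀ l : Fin n, j ≤ l → m l = 0 := by
    intro l hl
    by_contra hne
    have := mem_supported.1 hf ((mem_vars_iff_mem_support l).2 ⟨m, hm, Finsupp.mem_support_iff.2 hne⟩)
    exact absurd (show (l : ℕ) < j from this) (not_lt.2 hl)
  obtain ⟨i, hji, hi, hil⟩ := h
  refine Or.inl ⟨i, hji, ?_, fun l hl => ?_⟩
  · rwa [Finsupp.add_apply, h0 i hji, add_zero]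
  · rw [Finsupp.add_apply, h0 l (hji.trans hl.le), add_zero, hil l hl]

/-- Some nonempty initial segment of `β` has sum at least its length minus `s`. -/
def Reaches : ℤ → List ℕ → Prop
  | _, [] => False
  | s, a :: β => 1 ≤ s + a ∨ Reaches (s + a - 1) β

theorem Reaches.mono {s s' : ℤ} (h : s ≤ s') {β : List ℕ} (hs : Reaches s β) : Reaches s' β := by
  induction β generalizing s s' with
  | nil => exact hs
  | cons a β ih =>
    rcases hs with hs | hs
    · exact Or.inl (by omega)
    · exact Or.inr (ih (by omega) hs)

/-- The sum of the entries of `w` at some position `i ≥ j` and above is at least `n - i`. -/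
def Transdiagonal {n : ℕ} (j : ℕ) (w : Fin n →₀ ℕ) : Prop :=
  ∃ i : Fin n, j ≤ i ∧ n ≤ (∑ l, if i ≤ l then w l else 0) + i

theorem transdiagonal_of_le {n j : ℕ} (hj : j ≤ n) {w : Fin n →₀ ℕ}
    (hw : ∀ l : Fin n, l < j → w l = 0) (h : n + 1 ≤ (∑ l, w l) + j) : Transdiagonal j w := by
  rcases hj.lt_or_eq with hlt | rfl
  · refine ⟨⟨j, hlt⟩, le_rfl, ?_⟩
    have : (∑ l, if ⟨j, hlt⟩ ≤ l then w l else 0) = ∑ l, w l := by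
      refine Finset.sum_congr rfl fun l _ => ?_
      split_ifs with hl
      · rfl
      · exact (hw l (by simpa [Fin.le_def] using hl)).symm
    rw [this]
    simp only
    omega
  · rw [Finset.sum_eq_zero fun l _ => hw l l.2] at h
    omega

theorem Transdiagonal.of_succ {n j : ℕ} {w w' : Fin n →₀ ℕ}
    (h : ∀ l : Fin n, j + 1 ≤ l → w' l = w l)
    (ht : ∃ i : Fin n, j + 1 ≤ i ∧ n ≤ (∑ l, if i ≤ l then w l else 0) + i) :
    Transdiagonal (j + 1) w' := by
  obtain ⟨i, hi, h1⟩ := ht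
  refine ⟨i, hi, h1.trans (le_of_eq ?_)⟩
  congr 1
  refine Finset.sum_congr rfl fun l _ => ?_
  split_ifs with hl
  · rw [h l (hi.trans hl)]
  · rfl

/-- The sum of the ideal generated by quasisymmetric polynomials and the polynomials with small
monomials. -/
noncomputable def modLex {n : ℕ} (j : ℕ) (w : Fin n →₀ ℕ) : Submodule ℚ (MvPolynomial (Fin n) ℚ) :=
  (idealQSymPlus n).restrictScalars ℚ ⊔ lexBelow j w

theorem mul_monomial_mem_modLex {n j : ℕ} {w u : Fin n →₀ ℕ} (hu : ∀ l : Fin n, j ≤ l → u l = 0)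
    {f : MvPolynomial (Fin n) ℚ} (hf : f ∈ modLex j w) : monomial u 1 * f ∈ modLex j w := by
  obtain ⟨g, hg, h, hh, rfl⟩ := Submodule.mem_sup.1 hf
  rw [mul_add]
  exact Submodule.add_mem_sup (Ideal.mul_mem_left _ _ hg) (mul_monomial_mem_lexBelow hu hh)

theorem modLex_mono {n j j' : ℕ} (hj : j ≤ j') {w w' : Fin n →₀ ℕ}
    (h : ∀ l : Fin n, j' ≤ l → w' l = w l) : modLex j' w' ≤ modLex j w :=
  sup_le_sup_left (lexBelow_mono hj h) _

/-- The product has `w` as its part in the variables from `x_j` on and a fundamental polynomial in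
the earlier ones. Descending from `j = n`, where fundamental polynomials are generators of the
ideal, to `j = 0` with `β = []` gives the reduction of a transdiagonal monomial. The numerical
condition is the one that survives each descent and forces `β ≠ []` at `j = n`. -/
theorem monomial_mul_fundamental_mem_modLex (n j : ℕ) (hj : j ≤ n) :
    ∀ w : Fin n →₀ ℕ, (∀ l : Fin n, l < j → w l = 0) → ∀ β : List ℕ, (∀ a ∈ β, 0 < a) →
      (Transdiagonal j w ∨ Reaches ((∑ l, w l : ℕ) + j - n) β) →
      monomial w 1 * fundamental n j β ∈ modLex j w := by
  induction hj using Nat.decreasingInduction with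
  | self =>
    intro w hw β hβ h
    have hw0 : w = 0 := Finsupp.ext fun l => hw l l.2
    subst hw0
    rcases h with ⟨i, hi, _⟩ | h
    · exact absurd i.2 (not_lt.2 hi)
    · rw [monomial_zero', map_one, one_mul]
      exact Submodule.mem_sup_left (fundamental_mem_idealQSymPlus n hβ (by rintro rfl; exact h))
  | of_succ j hj ih =>
    intro w hw β hβ h
    set J : Fin n := ⟨j, hj⟩ with hJ
    have hgt : ∀ l : Fin n, j + 1 ≤ l → l ≠ J := by
      rintro l hl rfl
      simp [hJ] at hl
    set w' := w.erase J with hw'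
    have hsum : w' + Finsupp.single J (w J) = w := by rw [hw', Finsupp.erase_add_single]
    have hw'0 : ∀ l : Fin n, (l : ℕ) < j + 1 → w' l = 0 := by
      intro l hl
      by_cases hlJ : l = J
      · rw [hlJ, hw', Finsupp.erase_same]
      · rw [hw', Finsupp.erase_ne hlJ]
        refine hw l ?_
        have : (l : ℕ) ≠ j := fun he => hlJ (Fin.ext he)
        omega
    have hw'e : ∀ l : Fin n, j + 1 ≤ l → w' l = w l := fun l hl => by
      rw [hw', Finsupp.erase_ne (hgt l hl)]
    have htot : ∑ l, w l = ∑ l, w' l + w J := by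
      conv_lhs => rw [← hsum]
      simp [Finset.sum_add_distrib, Finsupp.single_apply]
    have hvar : var n j = X J := var_of_lt hj
    have hvm : var n j = monomial (Finsupp.single J 1) 1 := hvar
    have hu : ∀ l : Fin n, j + 1 ≤ l → Finsupp.single J 1 l = 0 := fun l hl =>
      Finsupp.single_eq_of_ne (hgt l hl)
    have hle : modLex (j + 1) w' ≤ modLex j w := modLex_mono (Nat.le_succ j) hw'e
    have htrans : Transdiagonal j w → Transdiagonal (j + 1) w' ∨ n ≤ ∑ l, w l + j := by
      rintro ⟨i, hi, h1⟩
      rcases hi.lt_or_eq with hlt | heq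
      · exact Or.inl (Transdiagonal.of_succ hw'e ⟨i, hlt, h1⟩)
      · right
        rw [heq]
        refine h1.trans (Nat.add_le_add_right (Finset.sum_le_sum fun l _ => ?_) _)
        split_ifs <;> simp
    rcases Nat.eq_zero_or_pos (w J) with hc | hc
    · have hww : w' = w := by rw [← hsum, hc, Finsupp.single_zero, add_zero]
      rw [hww] at hw'0 hle htrans
      have htd : Transdiagonal j w → Transdiagonal (j + 1) w := fun ht =>
        (htrans ht).elim id fun h1 => transdiagonal_of_le hj hw'0 (by omega)
      -- With `x_j` absent from `w`, write `F_j(a + 1, β) = F_(j+1)(a + 1, β) - x_j F_(j+1)(a, β)`.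
      -- For `a = 0` the last factor is `F_j(β)`, at the same level `j` with a shorter list, which
      -- is why an inner induction on `β` is needed.
      induction β with
      | nil =>
        rw [fundamental_nil, ← fundamental_nil n (j + 1)]
        exact hle (ih w hw'0 [] hβ (h.imp htd id))
      | cons a β ihβ =>
        obtain ⟨a, rfl⟩ : ∃ b, a = b + 1 :=
          ⟨a - 1, by have := hβ a List.mem_cons_self; omega⟩
        have hβ' : ∀ b ∈ β, 0 < b := fun b hb => hβ b (List.mem_cons_of_mem _ hb)
        have e := fundamental_succ_succ_cons n j a β
        rw [show fundamental n j ((a + 1) :: β) = fundamental n (j + 1) ((a + 1) :: β) -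
          var n j * fundamental n (j + 1) (a :: β) by rw [e]; ring, mul_sub, hvm,
          mul_left_comm]
        refine sub_mem (hle (ih w hw'0 _ hβ (h.imp htd fun h => h.mono (by omega)))) ?_
        · rcases Nat.eq_zero_or_pos a with rfl | ha
          · rw [fundamental_succ_zero_cons]
            have hmem : monomial w 1 * fundamental n j β ∈ modLex (j + 1) w := by
              -- Since `w` vanishes at position `j`, no monomial can first drop below `w` there.
              have : modLex j w ≤ modLex (j + 1) w := by
                refine sup_le_sup_left (restrictSupport_mono ℚ ?_) _
                rintro m ⟨i, hi, h1, h2⟩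
                refine ⟨i, ?_, h1, h2⟩
                rcases hi.lt_or_eq with hlt | heq
                · exact hlt
                · have : i = J := Fin.ext heq.symm
                  rw [this, hc] at h1
                  omega
              refine this (ihβ hβ' ?_)
              rcases h with h | h | h
              · exact Or.inl h
              · refine Or.inl ?_
                obtain ⟨i, hi, h1⟩ := transdiagonal_of_le hj hw'0 (by omega)
                exact ⟨i, by omega, h1⟩
              · exact Or.inr (h.mono (by omega))
            exact hle (mul_monomial_mem_modLex hu hmem)
          · refine hle (mul_monomial_mem_modLex hu (ih w hw'0 _ ?_ ?_))
            · intro b hb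
              rcases List.mem_cons.1 hb with rfl | hb
              · exact ha
              · exact hβ' b hb
            · rcases h with h | h | h
              · exact Or.inl (htd h)
              · exact Or.inr (Or.inl (by omega))
              · exact Or.inr (Or.inr (h.mono (by omega)))
    -- The exponent of `x_j` becomes a new first part. In the expansion of `F_(j+1)(w J, β)` in
    -- powers of `x_j`, the top term yields the wanted product, and all others carry a smaller power
    -- of `x_j`, so they are lexicographically below `w`. The one-part prefix covers the case `n ≤
    -- |w| + j`, longer prefixes the condition on `β`.
    · have h1 : monomial w' 1 * fundamental n (j + 1) (w J :: β) ∈ modLex j w := by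
        refine hle (ih w' hw'0 _ ?_ ?_)
        · intro b hb
          rcases List.mem_cons.1 hb with rfl | hb
          · exact hc
          · exact hβ b hb
        · rcases h with h | h
          · refine (htrans h).imp id fun h1 => Or.inl ?_
            omega
          · refine Or.inr (Or.inr (h.mono ?_))
            omega
      have hpow : ∀ c, monomial w' 1 * var n j ^ c =
          (monomial (w' + Finsupp.single J c) 1 : MvPolynomial (Fin n) ℚ) := by
        intro c
        rw [hvar, X_pow_eq_monomial, monomial_mul, one_mul]
      rw [fundamental_succ_cons, mul_add, Finset.mul_sum] at h1
      simp only [← mul_assoc, hpow] at h1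
      rw [hsum] at h1
      refine (Submodule.add_mem_iff_right _ ?_).1 h1
      refine sum_mem fun c hcr => Submodule.mem_sup_right
        (monomial_mul_mem_lexBelow ⟨J, le_rfl, ?_, fun l hl => ?_⟩ (fundamental_mem_supported n j _))
      · rw [Finset.mem_range] at hcr
        rw [Finsupp.add_apply, hw'0 J (Nat.lt_succ_self j), Finsupp.single_eq_same, zero_add]
        exact hcr
      · rw [Finsupp.add_apply, Finsupp.single_eq_of_ne hl.ne', add_zero, hw'e l hl]

theorem wellFounded_lexBelow (n : ℕ) : WellFounded (LexBelow (n := n) 0) := by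
  have h : WellFounded (Pi.Lex (fun a b : Fin n => b < a) fun {_} (x y : ℕ) => x < y) :=
    Pi.Lex.wellFounded _ fun _ => wellFounded_lt
  refine Subrelation.wf ?_ (InvImage.wf (fun m : Fin n →₀ ℕ => (m : Fin n → ℕ)) h)
  rintro m w ⟨i, _, h1, h2⟩
  exact ⟨i, h2, h1⟩

/-- The polynomials spanned by subdiagonal monomials. -/
noncomputable def subDiagPoly (n : ℕ) : Submodule ℚ (MvPolynomial (Fin n) ℚ) :=
  restrictSupport ℚ {w | SubDiag n 0 w}

theorem idealQSymPlus_sup_subDiagPoly (n : ℕ) :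
    (idealQSymPlus n).restrictScalars ℚ ⊔ subDiagPoly n = ⊤ := by
  have key : ∀ w : Fin n →₀ ℕ,
      monomial w 1 ∈ (idealQSymPlus n).restrictScalars ℚ ⊔ subDiagPoly n := by
    intro w
    induction w using (wellFounded_lexBelow n).induction with
    | _ w ih =>
      by_cases hw : SubDiag n 0 w
      · exact Submodule.mem_sup_right ((monomial_mem_restrictSupport _).2 (Or.inl hw))
      · have ht : Transdiagonal 0 w := by
          simp only [SubDiag, not_forall, not_lt, add_zero] at hw
          obtain ⟨i, hi⟩ := hw
          exact ⟨i, Nat.zero_le _, hi⟩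
        have := monomial_mul_fundamental_mem_modLex n 0 (Nat.zero_le n) w
          (fun l hl => absurd hl (Nat.not_lt_zero _)) [] (by simp) (Or.inl ht)
        rw [fundamental_nil, mul_one] at this
        refine (sup_le le_sup_left ?_ : modLex 0 w ≤ _) this
        rw [lexBelow, restrictSupport_eq_span, Submodule.span_le]
        rintro _ ⟨m, hm, rfl⟩
        exact ih m hm
  rw [eq_top_iff]
  intro f _
  rw [f.as_sum]
  refine sum_mem fun m _ => ?_
  rw [← mul_one (coeff m f), ← smul_eq_mul, ← smul_monomial]
  exact Submodule.smul_mem _ _ (key m)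

/-! ### Subdiagonal monomials are independent -/

theorem exists_eq_sum_single {n : ℕ} (m : Fin n →₀ ℕ) : ∃ (k : ℕ) (a : Fin k → ℕ)
    (i : Fin k ↪o Fin n), (∀ s, 0 < a s) ∧ m = ∑ s, Finsupp.single (i s) (a s) := by
  refine ⟨m.support.card, fun s => m (m.support.orderEmbOfFin rfl s),
    m.support.orderEmbOfFin rfl, fun s => ?_, ?_⟩
  · exact Nat.pos_of_ne_zero (Finsupp.mem_support_iff.1 (m.support.orderEmbOfFin_mem rfl s))
  · conv_lhs => rw [← m.sum_single, Finsupp.sum]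
    symm
    refine Finset.sum_bij (fun s _ => m.support.orderEmbOfFin rfl s)
      (fun s _ => m.support.orderEmbOfFin_mem rfl s)
      (fun s _ t _ h => (m.support.orderEmbOfFin rfl).injective h) (fun l hl => ?_)
      fun s _ => rfl
    have : l ∈ Set.range (m.support.orderEmbOfFin rfl) := by
      rw [Finset.range_orderEmbOfFin]; exact hl
    obtain ⟨s, hs⟩ := this
    exact ⟨s, Finset.mem_univ _, hs⟩

theorem IsQuasisymmetric.dropVar_eq {n : ℕ} {f : MvPolynomial (Fin (n + 1)) ℚ}
    (hf : IsQuasisymmetric f) (p q : Fin (n + 1)) : dropVar p f = dropVar q f := by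
  ext m
  obtain ⟨k, a, i, ha, rfl⟩ := exists_eq_sum_single m
  rw [coeff_dropVar, coeff_dropVar, mapDomain_sum_single, mapDomain_sum_single]
  exact hf k a ha (i.trans (Fin.succAboveOrderEmb p)) (i.trans (Fin.succAboveOrderEmb q))

theorem IsQuasisymmetric.dropVar {n : ℕ} {f : MvPolynomial (Fin (n + 1)) ℚ}
    (hf : IsQuasisymmetric f) (p : Fin (n + 1)) : IsQuasisymmetric (dropVar p f) := by
  intro k a ha i i'
  rw [coeff_dropVar, coeff_dropVar, mapDomain_sum_single, mapDomain_sum_single]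
  exact hf k a ha (i.trans (Fin.succAboveOrderEmb p)) (i'.trans (Fin.succAboveOrderEmb p))

theorem constantCoeff_dropVar {n : ℕ} (p : Fin (n + 1)) (f : MvPolynomial (Fin (n + 1)) ℚ) :
    constantCoeff (dropVar p f) = constantCoeff f := by
  rw [constantCoeff_eq, coeff_dropVar, Finsupp.mapDomain_zero]
  rfl

/-- The two deletions agree on all variables except `x_i` and `x_(i+1)`, where one gives `x_i` and
the other 0. Divisibility passes to products by the Leibniz identity. -/
theorem X_dvd_dropVar_sub {n : ℕ} (i : Fin n) (f : MvPolynomial (Fin (n + 1)) ℚ) :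
    X i ∣ dropVar i.succ f - dropVar i.castSucc f := by
  induction f using MvPolynomial.induction_on with
  | C a => simp [dropVar]
  | add p q hp hq =>
    rw [map_add, map_add, add_sub_add_comm]
    exact dvd_add hp hq
  | mul_X p l hp =>
    have hl : X i ∣ dropVar i.succ (X l) - dropVar i.castSucc (X l) := by
      by_cases h1 : l = i.succ
      · have h2 : i.succ = i.castSucc.succAbove i := (Fin.succAbove_castSucc_self i).symm
        rw [h1, dropVar_X_self]
        conv_rhs => rw [h2]
        rw [dropVar_X_succAbove, zero_sub, dvd_neg]
      · by_cases h2 : l = i.castSucc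
        · have h3 : i.castSucc = i.succ.succAbove i := (Fin.succAbove_succ_self i).symm
          rw [h2, dropVar_X_self]
          conv_rhs => rw [h3]
          rw [dropVar_X_succAbove, sub_zero]
        · obtain ⟨t, rfl⟩ := Fin.exists_succAbove_eq h1
          have h3 : i.succ.succAbove t = i.castSucc.succAbove t := by
            have hti : t ≠ i := by
              rintro rfl
              exact h2 (Fin.succAbove_succ_self t)
            rcases lt_or_gt_of_ne hti with h | h
            · rw [Fin.succAbove_of_castSucc_lt, Fin.succAbove_of_castSucc_lt]
              · exact h
              · exact (Fin.castSucc_lt_castSucc_iff.2 h).trans Fin.castSucc_lt_succ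
            · rw [Fin.succAbove_of_le_castSucc, Fin.succAbove_of_le_castSucc]
              · exact h.le
              · exact Fin.succ_le_castSucc_iff.2 h
          rw [dropVar_X_succAbove, h3, dropVar_X_succAbove, sub_self]
          exact dvd_zero _
    rw [map_mul, map_mul]
    have : dropVar i.succ p * dropVar i.succ (X l) - dropVar i.castSucc p * dropVar i.castSucc (X l)
        = dropVar i.succ p * (dropVar i.succ (X l) - dropVar i.castSucc (X l)) +
          (dropVar i.succ p - dropVar i.castSucc p) * dropVar i.castSucc (X l) := by ring
    rw [this]
    exact dvd_add (hl.mul_left _) (hp.mul_right _)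

/-- The quasisymmetric divided differences preserve the ideals generated by the quasisymmetric
polynomials without constant term. -/
theorem exists_dropVar_sub_eq {n : ℕ} (i : Fin n) {f : MvPolynomial (Fin (n + 1)) ℚ}
    (hf : f ∈ idealQSymPlus (n + 1)) :
    ∃ q ∈ idealQSymPlus n, dropVar i.succ f - dropVar i.castSucc f = X i * q := by
  induction hf using Submodule.span_induction with
  | mem g hg => exact ⟨0, zero_mem _, by rw [hg.1.dropVar_eq i.succ i.castSucc, sub_self, mul_zero]⟩
  | zero => exact ⟨0, zero_mem _, by simp⟩
  | add g h _ _ hg hh =>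
    obtain ⟨q, hq, hgq⟩ := hg
    obtain ⟨r, hr, hhr⟩ := hh
    exact ⟨q + r, add_mem hq hr, by rw [map_add, map_add, add_sub_add_comm, hgq, hhr, mul_add]⟩
  | smul h g hg' hg =>
    obtain ⟨q, hq, hgq⟩ := hg
    obtain ⟨r, hr⟩ := X_dvd_dropVar_sub i h
    -- Twisted Leibniz rule for `h * g`: the first term contains the divided difference `q` of `g`,
    -- the second the deletion `dropVar i.castSucc g`, which stays in the ideal because deletion
    -- preserves quasisymmetry and the constant term.
    refine ⟨dropVar i.succ h * q + r * dropVar i.castSucc g,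
      add_mem (Ideal.mul_mem_left _ _ hq) (Ideal.mul_mem_left _ _ ?_), ?_⟩
    · have hle : idealQSymPlus (n + 1) ≤ (idealQSymPlus n).comap (dropVar i.castSucc) :=
        Ideal.span_le.2 fun g hg => Ideal.subset_span
          ⟨hg.1.dropVar _, by rw [constantCoeff_dropVar]; exact hg.2⟩
      exact hle hg'
    · rw [smul_eq_mul, map_mul, map_mul, mul_add, mul_left_comm, ← hgq, ← mul_assoc, ← hr]
      ring

/-- The bound must improve by one when `n + 1` drops to `n`. For tails starting at `t ≤ i` the extra
factor `x_i` pays for it; for `t > i` the shift of positions from `t` to `t + 1` does. -/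
theorem SubDiag.of_succAbove {n : ℕ} (i : Fin n) {p : Fin (n + 1)}
    (hp : p = i.castSucc ∨ p = i.succ) {m : Fin n →₀ ℕ}
    (h : SubDiag (n + 1) 0 ((m + Finsupp.single i 1).mapDomain p.succAbove)) : SubDiag n 0 m := by
  have hval : ∀ l : Fin n, ((p.succAbove l : Fin (n + 1)) : ℕ) = if (l : ℕ) < p then (l : ℕ)
      else l + 1 := by
    intro l
    split_ifs with hl
    · rw [Fin.succAbove_of_castSucc_lt _ _ (by simpa [Fin.lt_def] using hl), Fin.val_castSucc]
    · rw [Fin.succAbove_of_le_castSucc _ _ (by simpa [Fin.le_def] using hl), Fin.val_succ]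
  have hpv : (p : ℕ) = i ∨ (p : ℕ) = i + 1 := by
    rcases hp with rfl | rfl <;> simp
  have hsum : ∀ t : Fin (n + 1), (∑ l, if t ≤ l then
      ((m + Finsupp.single i 1).mapDomain p.succAbove) l else 0) =
      (∑ l, if t ≤ p.succAbove l then m l else 0) + if t ≤ p.succAbove i then 1 else 0 := by
    intro t
    rw [Fin.sum_univ_succAbove _ p, Finsupp.mapDomain_of_notMem_range, ite_self, zero_add]
    · simp only [Finsupp.mapDomain_apply (Fin.succAbove_right_injective (p := p))]
      rw [← Finset.sum_add_sum_compl {i}]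
      conv_rhs => rw [← Finset.sum_add_sum_compl {i}]
      rw [Finset.sum_singleton, Finset.sum_singleton, add_right_comm]
      congr 1
      · split_ifs <;> simp
      · refine Finset.sum_congr rfl fun l hl => ?_
        have : l ≠ i := by simpa using hl
        simp [Finsupp.single_eq_of_ne this]
    · rintro ⟨l, hl⟩
      exact Fin.succAbove_ne p l hl
  intro t
  have hcmp : ∀ t' : Fin (n + 1), (∀ l, t' ≤ p.succAbove l ↔ t ≤ l) →
      (∑ l, if t ≤ l then m l else 0) + (if t ≤ i then 1 else 0) + t' < n + 1 := by
    intro t' ht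
    have := h t'
    rw [hsum] at this
    simpa only [ht, add_zero] using this
  by_cases hti : t ≤ i
  · have := hcmp t.castSucc fun l => by
      rw [Fin.le_def, Fin.le_def, hval, Fin.val_castSucc]
      rw [Fin.le_def] at hti
      split_ifs <;> omega
    rw [if_pos hti, Fin.val_castSucc] at this
    omega
  · have := hcmp t.succ fun l => by
      rw [Fin.le_def, Fin.le_def, hval, Fin.val_succ]
      rw [Fin.le_def] at hti
      split_ifs <;> omega
    rw [Fin.val_succ] at this
    omega

/-- Equality of the two deletions allows the last nonzero exponent of a monomial to move one place
to the right without changing the coefficient. Once it is in the last position the monomial is not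
subdiagonal, so its coefficient is zero. -/
theorem coeff_eq_zero_of_dropVar_eq {n : ℕ} {f : MvPolynomial (Fin (n + 1)) ℚ}
    (hf : f ∈ subDiagPoly (n + 1))
    (h : ∀ i : Fin n, dropVar i.succ f = dropVar i.castSucc f) {w : Fin (n + 1) →₀ ℕ}
    (hw : w ≠ 0) : f.coeff w = 0 := by
  have key : ∀ p : Fin (n + 1), ∀ w : Fin (n + 1) →₀ ℕ, w p ≠ 0 → (∀ l, p < l → w l = 0) →
      f.coeff w = 0 := by
    intro p
    induction p using Fin.reverseInduction with
    | last =>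
      intro w hp _
      by_contra hne
      have h1 : SubDiag (n + 1) 0 w := hf (mem_support_iff.2 hne)
      have h2 := h1 (Fin.last n)
      have h3 := Finset.single_le_sum (f := fun l => if Fin.last n ≤ l then w l else 0)
        (fun l _ => Nat.zero_le _) (Finset.mem_univ (Fin.last n))
      simp only [le_refl, if_true] at h3
      rw [Fin.val_last] at h2
      omega
    | cast i ih =>
      intro w hp hl
      have hi : w i.succ = 0 := hl _ Fin.castSucc_lt_succ
      -- Remove the zero entry of `w` at `i + 1`, then insert a zero at `i` instead: this moves the
      -- last nonzero exponent from `i` to `i + 1`.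
      set m : Fin n →₀ ℕ := w.comapDomain i.succ.succAbove
        (Fin.succAbove_right_injective).injOn with hm
      have hwm : m.mapDomain i.succ.succAbove = w := by
        refine Finsupp.mapDomain_comapDomain _ Fin.succAbove_right_injective _ fun l hl' => ?_
        refine Fin.exists_succAbove_eq ?_
        rintro rfl
        exact Finsupp.mem_support_iff.1 hl' hi
      rw [← hwm, ← coeff_dropVar, h, coeff_dropVar]
      have hinj := Fin.succAbove_right_injective (p := i.castSucc)
      apply ih
      · rw [← Fin.succAbove_castSucc_self, Finsupp.mapDomain_apply hinj, hm,
          Finsupp.comapDomain_apply, Fin.succAbove_succ_self]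
        exact hp
      · intro l hil
        obtain ⟨t, rfl⟩ := Fin.exists_succAbove_eq
          (show l ≠ i.castSucc from (Fin.castSucc_lt_succ.trans hil).ne')
        rw [Finsupp.mapDomain_apply hinj, hm, Finsupp.comapDomain_apply]
        refine hl _ ?_
        have hti : i < t := by
          by_contra hcon
          rcases (not_lt.1 hcon).lt_or_eq with h' | h'
          · rw [Fin.succAbove_of_castSucc_lt _ _ h'] at hil
            simp only [Fin.lt_def, Fin.val_succ, Fin.val_castSucc] at hil h'
            omega
          · rw [h', Fin.succAbove_castSucc_self] at hil
            exact lt_irrefl _ hil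
        rw [Fin.succAbove_of_le_castSucc _ _ (Fin.succ_le_castSucc_iff.2 hti)]
        exact (Fin.castSucc_lt_castSucc_iff.2 hti).trans Fin.castSucc_lt_succ
  obtain ⟨l, hl⟩ := Finsupp.ne_iff.1 hw
  have hne : w.support.Nonempty := ⟨l, Finsupp.mem_support_iff.2 hl⟩
  refine key (w.support.max' hne) w (Finsupp.mem_support_iff.1 (w.support.max'_mem hne))
    fun l hl => ?_
  by_contra hcon
  exact absurd (w.support.le_max' l (Finsupp.mem_support_iff.2 hcon)) (not_le.2 hl)

theorem constantCoeff_eq_zero_of_mem {n : ℕ} {f : MvPolynomial (Fin n) ℚ}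
    (hf : f ∈ idealQSymPlus n) : constantCoeff f = 0 :=
  (Ideal.span_le.2 fun _ hg => hg.2 : idealQSymPlus n ≤ RingHom.ker constantCoeff) hf

theorem eq_zero_of_mem_subDiagPoly {n : ℕ} {f : MvPolynomial (Fin n) ℚ}
    (hf : f ∈ idealQSymPlus n) (hs : f ∈ subDiagPoly n) : f = 0 := by
  induction n with
  | zero =>
    ext w
    rw [Subsingleton.elim w 0, coeff_zero]
    exact constantCoeff_eq_zero_of_mem hf
  | succ n ih =>
    have h : ∀ i : Fin n, dropVar i.succ f = dropVar i.castSucc f := by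
      intro i
      obtain ⟨q, hq, he⟩ := exists_dropVar_sub_eq i hf
      -- A monomial `m` of `q` gives `x_i * m` in one of the two deletions, hence a subdiagonal
      -- monomial of `f`. So `q` is subdiagonal and lies in the ideal for `n`, and induction
      -- applies.
      have hq0 : q = 0 := by
        refine ih hq fun m hm => ?_
        have hc : coeff (m + Finsupp.single i 1) (dropVar i.succ f - dropVar i.castSucc f) ≠ 0 := by
          rw [he, add_comm, coeff_X_mul]
          exact mem_support_iff.1 hm
        rw [coeff_sub, coeff_dropVar, coeff_dropVar] at hc
        by_cases h1 : f.coeff ((m + Finsupp.single i 1).mapDomain i.succ.succAbove) = 0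
        · rw [h1, zero_sub, neg_ne_zero] at hc
          exact SubDiag.of_succAbove i (Or.inl rfl) (hs (mem_support_iff.2 hc))
        · exact SubDiag.of_succAbove i (Or.inr rfl) (hs (mem_support_iff.2 h1))
      rw [hq0, mul_zero] at he
      exact sub_eq_zero.1 he
    ext w
    rw [coeff_zero]
    by_cases hw : w = 0
    · rw [hw]
      exact constantCoeff_eq_zero_of_mem hf
    · exact coeff_eq_zero_of_dropVar_eq hs h hw

/-! ### Dimensions of the two quotients -/

theorem rank_subDiagPoly (n : ℕ) : Module.rank ℚ (subDiagPoly n) = (catalan n : Cardinal) := by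
  let e : {w : Fin n →₀ ℕ | SubDiag n 0 w} ≃ {w : Fin n → ℕ // SubDiag n 0 w} :=
    Finsupp.equivFunOnFinite.subtypeEquiv fun _ => Iff.rfl
  have : Finite {w : Fin n →₀ ℕ | SubDiag n 0 w} := Finite.of_equiv _ e.symm
  rw [subDiagPoly, ← (basisRestrictSupport ℚ {w : Fin n →₀ ℕ | SubDiag n 0 w}).mk_eq_rank'',
    ← Nat.cast_card, Nat.card_congr e, card_subDiag]

theorem rank_quotient_idealQSymPlus (n : ℕ) :
    Module.rank ℚ (MvPolynomial (Fin n) ℚ ⧸ idealQSymPlus n) = (catalan n : Cardinal) := by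
  let φ : subDiagPoly n →ₗ[ℚ] MvPolynomial (Fin n) ℚ ⧸ idealQSymPlus n :=
    (Ideal.Quotient.mkₐ ℚ (idealQSymPlus n)).toLinearMap ∘ₗ (subDiagPoly n).subtype
  have hφ : ∀ f, φ f = Ideal.Quotient.mk (idealQSymPlus n) f := fun _ => rfl
  have hb : Function.Bijective φ := by
    constructor
    · rw [injective_iff_map_eq_zero]
      intro f hf
      rw [hφ, Ideal.Quotient.eq_zero_iff_mem] at hf
      exact Subtype.ext (eq_zero_of_mem_subDiagPoly hf f.2)
    · intro x
      obtain ⟨f, rfl⟩ := Ideal.Quotient.mk_surjective x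
      have hf : f ∈ (idealQSymPlus n).restrictScalars ℚ ⊔ subDiagPoly n := by
        rw [idealQSymPlus_sup_subDiagPoly]; trivial
      obtain ⟨g, hg, h, hh, rfl⟩ := Submodule.mem_sup.1 hf
      refine ⟨⟨h, hh⟩, ?_⟩
      rw [hφ, map_add, Ideal.Quotient.eq_zero_iff_mem.2 hg, zero_add]
  rw [← (LinearEquiv.ofBijective φ hb).rank_eq, rank_subDiagPoly]

theorem rank_quotient_idealQSV (n : ℕ) :
    Module.rank ℚ (MvPolynomial (Fin n) ℚ ⧸ idealQSV n) = (catalan n : Cardinal) := by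
  have : Finite (point '' QSV n : Set (Fin n → ℚ)) := finite_point_image_QSV n
  rw [idealQSV, rank_quotient_vanishingIdeal, card_point_image_QSV]

end QuasisymmetricVariety

theorem mainTheorem9 (n : ℕ) :
    Nonempty ((MvPolynomial (Fin n) ℚ ⧸ QuasisymmetricVariety.idealQSymPlus n) ≃ₗ[ℚ]
      (MvPolynomial (Fin n) ℚ ⧸ QuasisymmetricVariety.idealQSV n)) ∧
    Module.rank ℚ (MvPolynomial (Fin n) ℚ ⧸ QuasisymmetricVariety.idealQSymPlus n) =
      (catalan n : Cardinal) ∧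
    Module.rank ℚ (MvPolynomial (Fin n) ℚ ⧸ QuasisymmetricVariety.idealQSV n) =
      (catalan n : Cardinal) := by
  have h1 := QuasisymmetricVariety.rank_quotient_idealQSymPlus n
  have h2 := QuasisymmetricVariety.rank_quotient_idealQSV n
  exact ⟨nonempty_linearEquiv_of_rank_eq (h1.trans h2.symm), h1, h2⟩
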